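/- All digraphs here may have loops and multiple edges, and all edges are distinguishable. A 2-in, 2-out digraph is a finite digraph in which every vertex has in-degree two and out-degree two. An Euler circuit of $D$ is a cyclic sequence of edges (without a distinguished starting point) that contains each edge of $D$ exactly once and in which each edge ends at the vertex where the next one starts. For an Euler circuit $C$ of a 2-in, 2-out digraph $D$, the interlace graph $H(C)$ is the simple graph on the vertex set of $D$ in which distinct vertices $a$ and $b$ are adjacent if and only if $C$ visits them in the cyclic order $\ldots a \ldots b \ldots a \ldots b \ldots$. A graph is called an interlace graph if it equals $H(C)$ for some such $C$ and $D$. For a simple graph $G$ and distinct vertices $a, b$, the pivot $G^{ab}$ is obtained from $G$ by toggling (edge to non-edge and conversely) every pair $xy$ of vertices other than $a, b$ such that $x$ and $y$ lie in two different ones of the following three classes: vertices adjacent to $a$ but not $b$; vertices adjacent to $b$ but not $a$; vertices adjacent to both $a$ and $b$. $G - a$ denotes $G$ with the vertex $a$ deleted. Theorem. There exists a function $q_1$ from the class of interlace graphs to the integers such that, for every 2-in, 2-out digraph $D$ and every Euler circuit $C$ of $D$, the number of Euler circuits of $D$ equals $q_1(H(C))$. Moreover, whenever $ab$ is an edge of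 an interlace graph $H$, both $H-a$ and $H^{ab}-b$ are interlace graphs, and $q_1$ is the unique integer-valued function on interlace graphs that satisfies $$q_1(H) = \begin{cases} q_1(H-a) + q_1(H^{ab}-b) & \text{if } ab \text{ is an edge of } H,\\ 1 & \text{if } H \text{ has no edges,}\end{cases}$$ the first line being required for every edge $ab$ of $H$, with either choice of which endpoint is called $a$. -/

import Mathlib

universe u

/-- A directed graph on the vertex set `V` whose edges form the type `E`. Loops and multiple edges
are allowed, and all edges (including parallel edges and loops at the same vertex) are
distinguishable. -/
structure MultiDigraph (V E : Type u) where
  /-- The vertex that an edge leaves. -/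
  tail : E → V
  /-- The vertex that an edge enters. -/
  head : E → V

namespace MultiDigraph

variable {V E : Type u}

/-- Every vertex has in-degree two and out-degree two (a loop contributes one to each). -/
def IsTwoInTwoOut (D : MultiDigraph V E) : Prop :=
  ∀ v : V, {e : E | D.head e = v}.ncard = 2 ∧ {e : E | D.tail e = v}.ncard = 2

/-- An Euler circuit: a cyclic sequence of edges that contains every edge exactly once, each edge
entering the vertex that the cyclically next one leaves. A circuit has no distinguished starting
point. A two-in, two-out digraph which has an Euler circuit is automatically finite and connected,
since a cyclic sequence is finite. -/
def IsEulerCircuit (D : MultiDigraph V E) (C : Cycle E) : Prop :=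
  C.Nodup ∧ (∀ e : E, e ∈ C) ∧ C.Chain (fun e f => D.head e = D.tail f)

/-- `a` and `b` are interlaced in `C`: starting from some edge of `C`, the sequence of vertices
visited by `C` has the form `… a … b … a … b …`. -/
def Interlaced (D : MultiDigraph V E) (C : Cycle E) (a b : V) : Prop :=
  ∃ l : List V, (l : Cycle V) = C.map D.tail ∧ [a, b, a, b].Sublist l

theorem Interlaced.symm {D : MultiDigraph V E} {C : Cycle E} {a b : V}
    (h : D.Interlaced C a b) : D.Interlaced C b a := by
  obtain ⟨l, hl, hs⟩ := h
  obtain ⟨r₁, r₂, rfl, ha, hs⟩ := List.cons_sublist_iff.1 hs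
  refine ⟨r₂ ++ r₁, ?_, ?_⟩
  · rw [← hl]
    exact Cycle.coe_eq_coe.2 List.isRotated_append
  · exact hs.append (List.singleton_sublist.2 ha)

/-- The interlace graph `H(C)`: the simple graph on the vertices of `D` in which two distinct
vertices are adjacent iff they are interlaced in `C`. -/
def interlaceGraph (D : MultiDigraph V E) (C : Cycle E) : SimpleGraph V where
  Adj a b := a ≠ b ∧ D.Interlaced C a b
  symm := ⟨fun _ _ h => ⟨h.1.symm, h.2.symm⟩⟩
  loopless := ⟨fun _ h => h.1 rfl⟩

/-- The number of Euler circuits. -/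
noncomputable def numEulerCircuits (D : MultiDigraph V E) : ℕ :=
  Nat.card {C : Cycle E // D.IsEulerCircuit C}

end MultiDigraph

/-- `H` is an interlace graph: it is the interlace graph of some Euler circuit of some two-in,
two-out digraph. -/
def IsInterlaceGraph {V : Type u} (H : SimpleGraph V) : Prop :=
  ∃ (E : Type u) (D : MultiDigraph V E) (C : Cycle E),
    D.IsTwoInTwoOut ∧ D.IsEulerCircuit C ∧ D.interlaceGraph C = H

/-- The pairs `xy` toggled by pivoting on `ab`: `x` and `y` are vertices other than `a`, `b`, each
is adjacent to at least one of `a`, `b`, and they lie in different ones of the three classes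
"adjacent to `a` alone", "adjacent to `b` alone", "adjacent to both". -/
def PivotToggles {V : Type u} (G : SimpleGraph V) (a b x y : V) : Prop :=
  (x ≠ a ∧ x ≠ b ∧ (G.Adj x a ∨ G.Adj x b)) ∧
  (y ≠ a ∧ y ≠ b ∧ (G.Adj y a ∨ G.Adj y b)) ∧
  ¬ ((G.Adj x a ↔ G.Adj y a) ∧ (G.Adj x b ↔ G.Adj y b))

/-- The pivot `G^{ab}`. -/
def pivot {V : Type u} (G : SimpleGraph V) (a b : V) : SimpleGraph V where
  Adj x y := (G.Adj x y ∧ ¬ PivotToggles G a b x y) ∨ (¬ G.Adj x y ∧ PivotToggles G a b x y)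
  symm := ⟨fun x y h => by
    have e : PivotToggles G a b y x ↔ PivotToggles G a b x y := by
      unfold PivotToggles; tauto
    rwa [e, G.adj_comm y x]⟩
  loopless := ⟨fun x h => by
    rcases h with ⟨h, -⟩ | ⟨-, h⟩
    · exact G.loopless.irrefl x h
    · exact h.2.2 ⟨Iff.rfl, Iff.rfl⟩⟩

/-- `G - a`: the graph with the vertex `a` deleted. -/
abbrev deleteVertex {V : Type u} (G : SimpleGraph V) (a : V) :
    SimpleGraph ({a}ᶜ : Set V) :=
  G.induce {a}ᶜ

/-- An integer-valued function on the class of interlace graphs. -/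
abbrev InterlaceGraphFunction : Type (u + 1) :=
  ∀ (V : Type u) (H : SimpleGraph V), IsInterlaceGraph H → ℤ

/-- The recursion: whenever `ab` is an edge of an interlace graph `H`, the graphs `H - a` and
`H^{ab} - b` are interlace graphs and `q(H) = q(H - a) + q(H^{ab} - b)`; and `q(H) = 1` if `H` has
no edges. -/
def SatisfiesRecursion (q : InterlaceGraphFunction.{u}) : Prop :=
  (∀ (V : Type u) (H : SimpleGraph V) (hH : IsInterlaceGraph H) (a b : V), H.Adj a b →
    ∃ (h₁ : IsInterlaceGraph (deleteVertex H a))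
      (h₂ : IsInterlaceGraph (deleteVertex (pivot H a b) b)),
      q V H hH = q _ (deleteVertex H a) h₁ + q _ (deleteVertex (pivot H a b) b) h₂) ∧
  (∀ (V : Type u) (H : SimpleGraph V) (hH : IsInterlaceGraph H),
    (∀ a b : V, ¬ H.Adj a b) → q V H hH = 1)

/-! The function `q_1` counts the vertex sets `S`, including the empty one, whose principal
submatrix `A[S]` of the adjacency matrix over `ZMod 2` is nonsingular.

Counting circuits: fix an Euler circuit, viewed as a successor permutation `σ` of the edges. Any
other compatible successor permutation arises by exchanging the two outgoing edges at the vertices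
of a unique set `S`. Such a permutation is a single cycle exactly when its invariant `ZMod 2`-valued
functions are constant. Recording the jump of such a function at each vertex of `S` relates it to
the kernel of `A[S]`, so circuits correspond to nonsingular sets
(`IsTwoInTwoOut.numEulerCircuits_eq`).

Recursion: the sets avoiding `a` are those of `H - a`. Exchanging the coordinates at `a` and `b`
between a vector and its image under `A` turns `A` into the matrix of the pivot, up to interchanging
the two names; this matches the sets containing `a` with those of `H^{ab} - b`
(`numNonsingular_eq_add`).

Closure of the class: a circuit matters only through its cyclic word, in which each vertex occurs
twice. Deleting a letter, or exchanging two segments of the word, realizes the two graph operations.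
Uniqueness is induction on the number of vertices. -/

/-- The parity of the number of pairs of positions `i < j` of a list that carry `x` and `y`
respectively. -/
def pairParity {V : Type*} [DecidableEq V] : List V → V → V → ZMod 2
  | [], _, _ => 0
  | z :: l, x, y => (if z = x then (l.count y : ZMod 2) else 0) + pairParity l x y

/-! ### Interlacement as a parity of ordered pairs of positions. -/

section PairParity

variable {V W : Type*} [DecidableEq V] [DecidableEq W]

theorem pairParity_append (l m : List V) (x y : V) :
    pairParity (l ++ m) x y =
      pairParity l x y + pairParity m x y + (l.count x : ZMod 2) * (m.count y : ZMod 2) := by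
  induction l with
  | nil => simp [pairParity]
  | cons z l ih =>
    simp only [List.cons_append, pairParity, ih, List.count_append, List.count_cons, beq_iff_eq]
    split_ifs <;> push_cast <;> ring

theorem pairParity_filter (p : V → Bool) (l : List V) {x y : V} (hx : p x) (hy : p y) :
    pairParity (l.filter p) x y = pairParity l x y := by
  induction l with
  | nil => rfl
  | cons z l ih =>
    by_cases hz : p z
    · simp [hz, pairParity, ih, List.count_filter hy]
    · have : z ≠ x := by rintro rfl; exact hz hx
      simp [hz, pairParity, ih, this]

theorem pairParity_map {f : V → W} (hf : Function.Injective f) (l : List V) (x y : V) :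
    pairParity (l.map f) (f x) (f y) = pairParity l x y := by
  induction l with
  | nil => rfl
  | cons z l ih => simp [pairParity, ih, hf.eq_iff, List.count_map_of_injective _ _ hf]

/-- Moving a prefix `s` past `t` changes only the cross term, from (`x` in `s`)(`y` in `t`) to (`x`
in `t`)(`y` in `s`). Even total counts make the counts in `s` and `t` agree mod 2, so both products
coincide. -/
theorem pairParity_isRotated {l m : List V} (h : l ~r m) {x y : V} (hx : Even (l.count x))
    (hy : Even (l.count y)) : pairParity l x y = pairParity m x y := by
  obtain ⟨n, rfl⟩ := h
  rcases Nat.eq_zero_or_pos l.length with h | h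
  · obtain rfl := List.length_eq_zero_iff.1 h
    simp
  rw [← List.rotate_mod]
  set k := n % l.length
  have hk : k ≤ l.length := (Nat.mod_lt _ h).le
  rw [List.rotate_eq_drop_append_take hk]
  rw [← List.take_append_drop k l, List.count_append] at hx hy
  conv_lhs => rw [← List.take_append_drop k l]
  rw [pairParity_append, pairParity_append]
  generalize l.take k = s at *
  generalize l.drop k = t at *
  have hx' : (t.count x : ZMod 2) = s.count x := by
    have : ((s.count x + t.count x : ℕ) : ZMod 2) = 0 := (ZMod.natCast_eq_zero_iff_even).2 hx
    push_cast at this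
    rw [← CharTwo.sub_eq_add, sub_eq_zero] at this
    exact this.symm
  have hy' : (t.count y : ZMod 2) = s.count y := by
    have : ((s.count y + t.count y : ℕ) : ZMod 2) = 0 := (ZMod.natCast_eq_zero_iff_even).2 hy
    push_cast at this
    rw [← CharTwo.sub_eq_add, sub_eq_zero] at this
    exact this.symm
  rw [hx', hy']
  ring

theorem sublist_iff_filter_eq {l : List V} {a b : V} (hab : a ≠ b) (ha : l.count a = 2)
    (hb : l.count b = 2) :
    [a, b, a, b].Sublist l ↔ l.filter (fun z => z = a ∨ z = b) = [a, b, a, b] := by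
  have hlen : ∀ l : List V, (l.filter (fun z => z = a ∨ z = b)).length = l.count a + l.count b := by
    intro l
    induction l with
    | nil => rfl
    | cons z l ih =>
      simp only [Bool.decide_or] at ih ⊢
      by_cases h1 : z = a
      · subst h1; simp [hab, ih]; omega
      · by_cases h2 : z = b
        · subst h2; simp [h1, ih]; omega
        · simp [h1, h2, ih]
  constructor
  · intro h
    have h' := h.filter (fun z => z = a ∨ z = b)
    have h4 : [a, b, a, b].filter (fun z => z = a ∨ z = b) = [a, b, a, b] := by simp
    rw [h4] at h'
    exact (h'.eq_of_length (by rw [hlen, ha, hb]; rfl)).symm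
  · intro h
    rw [← h]
    exact List.filter_sublist

/-- Only the subword on `a` and `b` matters. Of its six possible forms, `abab` and `baba` have 3 and
1 pairs with `a` before `b`; the other four have 0, 2, 2 and 4. -/
theorem pairParity_eq_one_iff_sublist {l : List V} {a b : V} (hab : a ≠ b) (ha : l.count a = 2)
    (hb : l.count b = 2) :
    pairParity l a b = 1 ↔ [a, b, a, b].Sublist l ∨ [b, a, b, a].Sublist l := by
  have hm := pairParity_filter (fun z => z = a ∨ z = b) l (x := a) (y := b) (by simp) (by simp)
  have h2 : l.filter (fun z => z = b ∨ z = a) = l.filter (fun z => z = a ∨ z = b) := by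
    simp only [or_comm]
  rw [sublist_iff_filter_eq hab ha hb, sublist_iff_filter_eq hab.symm hb ha, h2, ← hm]
  have ca : (l.filter (fun z => z = a ∨ z = b)).count a = 2 := by
    rw [List.count_filter (by simp), ha]
  have cb : (l.filter (fun z => z = a ∨ z = b)).count b = 2 := by
    rw [List.count_filter (by simp), hb]
  have hmem : ∀ z ∈ l.filter (fun z => z = a ∨ z = b), z = a ∨ z = b := by
    intro z hz; simpa using (List.mem_filter.1 hz).2
  generalize l.filter (fun z => z = a ∨ z = b) = m at *
  clear hm h2 ha hb
  have hba := hab.symm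
  have two_eq : (2 : ZMod 2) = 0 := rfl
  rcases m with _ | ⟨w, _ | ⟨x, _ | ⟨y, _ | ⟨z, _ | ⟨z', m⟩⟩⟩⟩⟩
  · simp at ca
  · rcases hmem w (by simp) with rfl | rfl <;> simp [hba] at ca cb
  · rcases hmem w (by simp) with rfl | rfl <;> rcases hmem x (by simp) with rfl | rfl <;>
      simp [hab, hba] at ca cb
  · rcases hmem w (by simp) with rfl | rfl <;> rcases hmem x (by simp) with rfl | rfl <;>
      rcases hmem y (by simp) with rfl | rfl <;> simp [hab, hba] at ca cb
  · rcases hmem w (by simp) with rfl | rfl <;> rcases hmem x (by simp) with rfl | rfl <;>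
      rcases hmem y (by simp) with rfl | rfl <;> rcases hmem z (by simp) with rfl | rfl <;>
      simp [hab, hba] at ca cb <;> simp [pairParity, hab, hba, two_eq]
  · exfalso
    rcases hmem w (by simp) with rfl | rfl <;> rcases hmem x (by simp) with rfl | rfl <;>
      rcases hmem y (by simp) with rfl | rfl <;> rcases hmem z (by simp) with rfl | rfl <;>
      rcases hmem z' (by simp) with rfl | rfl <;>
      simp [hab, hba] at ca cb

theorem pairParity_eq_one_iff_isRotated {l : List V} {a b : V} (hab : a ≠ b) (ha : l.count a = 2)
    (hb : l.count b = 2) :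
    pairParity l a b = 1 ↔ ∃ m, m ~r l ∧ [a, b, a, b].Sublist m := by
  constructor
  · intro h
    rcases (pairParity_eq_one_iff_sublist hab ha hb).1 h with h | h
    · exact ⟨l, List.IsRotated.refl _, h⟩
    · obtain ⟨r₁, r₂, rfl, hb, hs⟩ := List.cons_sublist_iff.1 h
      exact ⟨r₂ ++ r₁, List.isRotated_append, hs.append (List.singleton_sublist.2 hb)⟩
  · rintro ⟨m, hm, hs⟩
    have hma : m.count a = 2 := by rw [hm.perm.count_eq, ha]
    have hmb : m.count b = 2 := by rw [hm.perm.count_eq, hb]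
    rw [← pairParity_isRotated hm (by rw [hma]; decide) (by rw [hmb]; decide)]
    exact (pairParity_eq_one_iff_sublist hab hma hmb).2 (Or.inl hs)

theorem pairParity_of_count_left_eq_zero {l : List V} {x : V} (hx : l.count x = 0) (y : V) :
    pairParity l x y = 0 := by
  induction l with
  | nil => rfl
  | cons z l ih =>
    have hz : z ≠ x := by rintro rfl; simp at hx
    rw [List.count_cons_of_ne hz] at hx
    simp [pairParity, hz, ih hx]

theorem pairParity_of_count_right_eq_zero {l : List V} {y : V} (x : V) (hy : l.count y = 0) :
    pairParity l x y = 0 := by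
  induction l with
  | nil => rfl
  | cons z l ih =>
    have hz : z ≠ y := by rintro rfl; simp at hy
    rw [List.count_cons_of_ne hz] at hy
    simp [pairParity, hy, ih hy]

end PairParity

/-! ### Euler circuits as double occurrence words; closure under deletion and pivoting. -/

section Words

variable {V E : Type u}

theorem Set.ncard_setOf_eq_count_map [DecidableEq V] {l : List E} (hl : l.Nodup)
    (hm : ∀ e, e ∈ l) (f : E → V) (v : V) : {e | f e = v}.ncard = (l.map f).count v := by
  classical
  have h : {e | f e = v} = ((l.filter (fun e => f e = v)).toFinset : Set E) := by
    ext e; simp [hm]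
  rw [h, Set.ncard_coe_finset, List.toFinset_card_of_nodup (hl.filter _), List.count,
    List.countP_map, List.countP_eq_length_filter]
  rfl

theorem Cycle.chain_coe_iff_getElem {r : E → E → Prop} (l : List E) :
    Cycle.Chain r (l : Cycle E) ↔
      ∀ (i : ℕ) (h : i < l.length),
        r l[i] (l[(i + 1) % l.length]'(Nat.mod_lt _ (Nat.zero_lt_of_lt h))) := by
  rcases l with _ | ⟨a, l⟩
  · simp
  rw [Cycle.chain_coe_cons, List.isChain_iff_getElem]
  have key : ∀ (i : ℕ) (h : i < (a :: l).length), (a :: (l ++ [a]))[i]'(by simp at h ⊢; omega) =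
      (a :: l)[i] := by
    intro i h
    rw [← List.getElem_append_left (bs := [a]) h]
    rfl
  have key' : ∀ (i : ℕ) (h : i < (a :: l).length),
      (a :: (l ++ [a]))[i + 1]'(by simp at h ⊢; omega) =
      (a :: l)[(i + 1) % (a :: l).length]'(Nat.mod_lt _ (Nat.zero_lt_of_lt h)) := by
    intro i h
    rcases Nat.lt_or_ge (i + 1) (a :: l).length with h' | h'
    · rw [key _ h']
      simp only [Nat.mod_eq_of_lt h']
    · have : i = l.length := by simp at h h'; omega
      subst this
      simp
  constructor
  · intro H i h
    have := H i (by simp at h ⊢; omega)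
    rwa [key _ h, key' _ h] at this
  · intro H i h
    have h' : i < (a :: l).length := by simp at h ⊢; omega
    rw [key _ h', key' _ h']
    exact H i h'

namespace MultiDigraph

theorem IsTwoInTwoOut.count_map_tail [DecidableEq V] {D : MultiDigraph V E}
    (hD : D.IsTwoInTwoOut) {l : List E} (hC : D.IsEulerCircuit (l : Cycle E)) (v : V) :
    (l.map D.tail).count v = 2 := by
  rw [← Set.ncard_setOf_eq_count_map (Cycle.nodup_coe_iff.1 hC.1)
    (fun e => Cycle.mem_coe_iff.1 (hC.2.1 e)), (hD v).2]

theorem IsTwoInTwoOut.interlaceGraph_adj_iff [DecidableEq V] {D : MultiDigraph V E}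
    (hD : D.IsTwoInTwoOut) {l : List E} (hC : D.IsEulerCircuit (l : Cycle E)) (a b : V) :
    (D.interlaceGraph (l : Cycle E)).Adj a b ↔ a ≠ b ∧ pairParity (l.map D.tail) a b = 1 := by
  refine and_congr_right fun hab => ?_
  rw [pairParity_eq_one_iff_isRotated hab (hD.count_map_tail hC a) (hD.count_map_tail hC b)]
  simp only [Interlaced, Cycle.map_coe, Cycle.coe_eq_coe]

/-- The digraph traced out by a cyclic word of vertices: one edge for each position. -/
def ofWord (w : List V) : MultiDigraph V (ULift.{u} (Fin w.length)) where
  tail e := w.get e.down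
  head e := w.get (finRotate _ e.down)

/-- The edges of `ofWord w` in cyclic order. -/
def wordCircuit (w : List V) : List (ULift.{u} (Fin w.length)) :=
  (List.finRange w.length).map ULift.up

theorem map_tail_wordCircuit (w : List V) : (wordCircuit w).map (ofWord w).tail = w := by
  simp [wordCircuit, ofWord, Function.comp_def]

theorem isEulerCircuit_wordCircuit (w : List V) :
    (ofWord w).IsEulerCircuit (wordCircuit w : Cycle _) := by
  refine ⟨Cycle.nodup_coe_iff.2 ((List.nodup_finRange _).map ULift.up_injective), ?_, ?_⟩
  · rintro ⟨e⟩
    simp [wordCircuit]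
  · rw [Cycle.chain_coe_iff_getElem]
    intro i h
    have h' : i < w.length := by simpa [wordCircuit] using h
    obtain ⟨n, hn⟩ : ∃ n, w.length = n + 1 := ⟨w.length - 1, by omega⟩
    simp only [wordCircuit, ofWord, List.getElem_map, List.getElem_finRange, List.length_map,
      List.length_finRange]
    congr 1
    ext
    simp [finRotate_apply, Fin.val_add, hn]

theorem isTwoInTwoOut_ofWord [DecidableEq V] {w : List V} (hw : ∀ v, w.count v = 2) :
    (ofWord w).IsTwoInTwoOut := by
  have ht : ∀ v, {e | (ofWord w).tail e = v}.ncard = 2 := by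
    intro v
    have hC := isEulerCircuit_wordCircuit w
    rw [Set.ncard_setOf_eq_count_map (Cycle.nodup_coe_iff.1 hC.1)
      (fun e => Cycle.mem_coe_iff.1 (hC.2.1 e)), map_tail_wordCircuit, hw]
  intro v
  refine ⟨?_, ht v⟩
  rw [← ht v]
  -- Heads are tails read one cyclic position later, so in-degrees are out-degrees transported by
  -- the rotation.
  let r : ULift.{u} (Fin w.length) ≃ ULift.{u} (Fin w.length) :=
    Equiv.ulift.trans ((finRotate _).trans Equiv.ulift.symm)
  have : {e | (ofWord w).head e = v} = r ⁻¹' {e | (ofWord w).tail e = v} := rfl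
  rw [this, ← Equiv.image_symm_eq_preimage, Set.ncard_image_of_injective _ r.symm.injective]

end MultiDigraph

/-- Interlace graphs are the interlace graphs of double occurrence words. -/
theorem isInterlaceGraph_iff_exists_word [DecidableEq V] {H : SimpleGraph V} :
    IsInterlaceGraph H ↔ ∃ w : List V, (∀ v, w.count v = 2) ∧
      ∀ a b, H.Adj a b ↔ a ≠ b ∧ pairParity w a b = 1 := by
  constructor
  · rintro ⟨E, D, C, hD, hC, rfl⟩
    induction C using Quotient.inductionOn with | h l => ?_
    exact ⟨l.map D.tail, hD.count_map_tail hC, hD.interlaceGraph_adj_iff hC⟩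
  · rintro ⟨w, hw, hH⟩
    refine ⟨_, MultiDigraph.ofWord w, (MultiDigraph.wordCircuit w : Cycle _),
      MultiDigraph.isTwoInTwoOut_ofWord hw, MultiDigraph.isEulerCircuit_wordCircuit w, ?_⟩
    ext a b
    rw [(MultiDigraph.isTwoInTwoOut_ofWord hw).interlaceGraph_adj_iff
      (MultiDigraph.isEulerCircuit_wordCircuit w), MultiDigraph.map_tail_wordCircuit, hH]

theorem IsInterlaceGraph.finite {H : SimpleGraph V} (hH : IsInterlaceGraph H) : Finite V := by
  classical
  obtain ⟨w, hw, -⟩ := isInterlaceGraph_iff_exists_word.1 hH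
  refine Set.finite_univ_iff.1 (w.toFinset.finite_toSet.subset fun v _ => ?_)
  have : v ∈ w := List.count_pos_iff.1 (by rw [hw]; norm_num)
  simpa using this

/-- Erasing both occurrences of `a` from the word leaves the relative order of all other letters
intact. -/
theorem IsInterlaceGraph.deleteVertex {H : SimpleGraph V} (hH : IsInterlaceGraph H) (a : V) :
    IsInterlaceGraph (deleteVertex H a) := by
  classical
  obtain ⟨w, hw, hadj⟩ := isInterlaceGraph_iff_exists_word.1 hH
  have hp : ∀ x : ({a}ᶜ : Set V), decide ((x : V) ≠ a) = true := fun x => decide_eq_true x.2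
  obtain ⟨w', hw'⟩ : ∃ w' : List ({a}ᶜ : Set V), w'.map (↑) = w.filter (fun x => x ≠ a) := by
    have : ∀ x ∈ w.filter (fun x => x ≠ a), x ∈ ({a}ᶜ : Set V) := fun x hx => by
      simpa using (List.mem_filter.1 hx).2
    lift w.filter (fun x => x ≠ a) to List ({a}ᶜ : Set V) using this with w'
    exact ⟨w', rfl⟩
  refine isInterlaceGraph_iff_exists_word.2 ⟨w', fun v => ?_, fun x y => ?_⟩
  · rw [← hw v, ← List.count_filter (p := fun x => x ≠ a) (hp v), ← hw',
      List.count_map_of_injective _ _ Subtype.val_injective]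
    congr!
  · rw [SimpleGraph.comap_adj, Function.Embedding.subtype_apply, Function.Embedding.subtype_apply,
      hadj, ← pairParity_filter (fun x => x ≠ a) w (hp x) (hp y), ← hw',
      pairParity_map Subtype.val_injective, ne_eq, ne_eq, Subtype.ext_iff]

/-- Rotate the word to `a P b Q a R b T`. Exchanging the segments `P` and `R` pivots the graph but
also swaps the roles of `a` and `b`; renaming them back gives `b R a Q b P a T`. -/
theorem IsInterlaceGraph.pivot {H : SimpleGraph V} (hH : IsInterlaceGraph H) {a b : V}
    (hab : H.Adj a b) : IsInterlaceGraph (pivot H a b) := by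
  classical
  obtain ⟨w, hw, hadj⟩ := isInterlaceGraph_iff_exists_word.1 hH
  obtain ⟨hne, hp⟩ := (hadj a b).1 hab
  obtain ⟨m, hm, hs⟩ := (pairParity_eq_one_iff_isRotated hne (hw a) (hw b)).1 hp
  obtain ⟨P, Q, R, T, hrot⟩ : ∃ P Q R T : List V,
      w ~r [a] ++ P ++ [b] ++ Q ++ [a] ++ R ++ [b] ++ T := by
    obtain ⟨r₁, m₁, rfl, h₁, hs⟩ := List.cons_sublist_iff.1 hs
    obtain ⟨r₂, m₂, rfl, h₂, hs⟩ := List.cons_sublist_iff.1 hs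
    obtain ⟨r₃, m₃, rfl, h₃, hs⟩ := List.cons_sublist_iff.1 hs
    obtain ⟨r₄, m₄, rfl, h₄, hs⟩ := List.cons_sublist_iff.1 hs
    obtain ⟨s₁, t₁, rfl⟩ := List.append_of_mem h₁
    obtain ⟨s₂, t₂, rfl⟩ := List.append_of_mem h₂
    obtain ⟨s₃, t₃, rfl⟩ := List.append_of_mem h₃
    obtain ⟨s₄, t₄, rfl⟩ := List.append_of_mem h₄
    -- The letters before the first `a` wrap around to the end of `T`.
    refine ⟨t₁ ++ s₂, t₂ ++ s₃, t₃ ++ s₄, t₄ ++ m₄ ++ s₁, hm.symm.trans ?_⟩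
    have := List.isRotated_append (l := s₁) (l' := [a] ++ (t₁ ++ s₂) ++ [b] ++ (t₂ ++ s₃) ++ [a] ++
      (t₃ ++ s₄) ++ [b] ++ (t₄ ++ m₄))
    simpa using this
  have hcount : ∀ v, ([a] ++ P ++ [b] ++ Q ++ [a] ++ R ++ [b] ++ T).count v = 2 := fun v => by
    rw [← hrot.perm.count_eq, hw]
  have hadj' : ∀ x y, H.Adj x y ↔
      x ≠ y ∧ pairParity ([a] ++ P ++ [b] ++ Q ++ [a] ++ R ++ [b] ++ T) x y = 1 := fun x y => by
    rw [hadj, pairParity_isRotated hrot (by rw [hw]; decide) (by rw [hw]; decide)]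
  clear hrot hm hs hp hadj hw
  refine isInterlaceGraph_iff_exists_word.2
    ⟨[b] ++ R ++ [a] ++ Q ++ [b] ++ P ++ [a] ++ T, fun v => ?_, fun x y => ?_⟩
  · rw [← hcount v]
    simp only [List.count_append]
    ring
  have ca := hcount a
  have cb := hcount b
  simp only [List.count_append, List.count_singleton_self, List.count_singleton, beq_iff_eq, hne,
    hne.symm, if_false] at ca cb
  obtain ⟨hPa, hQa, hRa, hTa⟩ : P.count a = 0 ∧ Q.count a = 0 ∧ R.count a = 0 ∧ T.count a = 0 := by
    omega
  obtain ⟨hPb, hQb, hRb, hTb⟩ : P.count b = 0 ∧ Q.count b = 0 ∧ R.count b = 0 ∧ T.count b = 0 := by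
    omega
  have two_eq : (2 : ZMod 2) = 0 := rfl
  -- The four counts add up to 2, which vanishes mod 2, so the count in `T` can be eliminated
  -- everywhere.
  have hsum : ∀ v, v ≠ a → v ≠ b →
      (T.count v : ZMod 2) = P.count v + Q.count v + R.count v := fun v hva hvb => by
    have h := congrArg (Nat.cast : ℕ → ZMod 2) (hcount v)
    simp only [List.count_append, List.count_singleton, beq_iff_eq, hva.symm, hvb.symm,
      if_false] at h
    push_cast at h
    linear_combination h - (P.count v + Q.count v + R.count v : ZMod 2) * two_eq + two_eq
  have left := fun (l : List V) (x y : V) (h : l.count x = 0) =>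
    pairParity_of_count_left_eq_zero h y
  have right := fun (l : List V) (x y : V) (h : l.count y = 0) =>
    pairParity_of_count_right_eq_zero x h
  have hne' := hne.symm
  have adj_a : ∀ x, x ≠ a → x ≠ b →
      (pairParity ([a] ++ P ++ [b] ++ Q ++ [a] ++ R ++ [b] ++ T) x a =
        P.count x + Q.count x ∧
      pairParity ([a] ++ P ++ [b] ++ Q ++ [a] ++ R ++ [b] ++ T) a x =
        P.count x + Q.count x) ∧
      (pairParity ([b] ++ R ++ [a] ++ Q ++ [b] ++ P ++ [a] ++ T) x a =
        P.count x + Q.count x ∧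
      pairParity ([b] ++ R ++ [a] ++ Q ++ [b] ++ P ++ [a] ++ T) a x =
        P.count x + Q.count x) := fun x hxa hxb => by
    have hxa' := hxa.symm
    have hxb' := hxb.symm
    have := hsum x hxa hxb
    simp only [pairParity_append, pairParity, List.count_append, List.count_singleton, beq_iff_eq,
      List.count_nil, left, right, hPa, hQa, hRa, hTa, hne', hxa', hxb', this,
      if_false, if_true, Nat.cast_add, Nat.cast_zero, Nat.cast_one]
    generalize (P.count x : ZMod 2) = p
    generalize (Q.count x : ZMod 2) = q
    generalize (R.count x : ZMod 2) = r
    revert p q r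
    decide
  have adj_b : ∀ x, x ≠ a → x ≠ b →
      (pairParity ([a] ++ P ++ [b] ++ Q ++ [a] ++ R ++ [b] ++ T) x b =
        Q.count x + R.count x ∧
      pairParity ([a] ++ P ++ [b] ++ Q ++ [a] ++ R ++ [b] ++ T) b x =
        Q.count x + R.count x) ∧
      (pairParity ([b] ++ R ++ [a] ++ Q ++ [b] ++ P ++ [a] ++ T) x b =
        Q.count x + R.count x ∧
      pairParity ([b] ++ R ++ [a] ++ Q ++ [b] ++ P ++ [a] ++ T) b x =
        Q.count x + R.count x) := fun x hxa hxb => by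
    have hxa' := hxa.symm
    have hxb' := hxb.symm
    have := hsum x hxa hxb
    simp only [pairParity_append, pairParity, List.count_append, List.count_singleton, beq_iff_eq,
      List.count_nil, left, right, hPb, hQb, hRb, hTb, hne, hxa', hxb', this,
      if_false, if_true, Nat.cast_add, Nat.cast_zero, Nat.cast_one]
    generalize (P.count x : ZMod 2) = p
    generalize (Q.count x : ZMod 2) = q
    generalize (R.count x : ZMod 2) = r
    revert p q r
    decide
  have adj_ab : (pairParity ([a] ++ P ++ [b] ++ Q ++ [a] ++ R ++ [b] ++ T) a b = 1 ∧
      pairParity ([a] ++ P ++ [b] ++ Q ++ [a] ++ R ++ [b] ++ T) b a = 1) ∧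
      (pairParity ([b] ++ R ++ [a] ++ Q ++ [b] ++ P ++ [a] ++ T) a b = 1 ∧
      pairParity ([b] ++ R ++ [a] ++ Q ++ [b] ++ P ++ [a] ++ T) b a = 1) := by
    simp only [pairParity_append, pairParity, List.count_append, List.count_singleton, beq_iff_eq,
      List.count_nil, left, right, hPa, hQa, hRa, hTa, hPb, hQb, hRb, hTb, hne, hne',
      if_false, if_true, Nat.cast_add, Nat.cast_zero, Nat.cast_one]
    decide
  -- The change is the determinant of the vectors (adjacency to `a`, adjacency to `b`) of `x` and
  -- `y`. Over `ZMod 2` it is 1 exactly when these are nonzero and distinct, which is the toggling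
  -- condition.
  have adj_xy : ∀ x y, x ≠ a → x ≠ b → y ≠ a → y ≠ b →
      pairParity ([b] ++ R ++ [a] ++ Q ++ [b] ++ P ++ [a] ++ T) x y =
        pairParity ([a] ++ P ++ [b] ++ Q ++ [a] ++ R ++ [b] ++ T) x y +
          (P.count x + Q.count x) * (Q.count y + R.count y) +
          (Q.count x + R.count x) * (P.count y + Q.count y) := fun x y hxa hxb hya hyb => by
    simp only [pairParity_append, pairParity, List.count_append, List.count_singleton, beq_iff_eq,
      List.count_nil, hxa.symm, hxb.symm, hya.symm, hyb.symm, hsum y hya hyb,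
      if_false, Nat.cast_add, Nat.cast_zero]
    generalize (P.count x : ZMod 2) = p
    generalize (Q.count x : ZMod 2) = q
    generalize (R.count x : ZMod 2) = r
    generalize (P.count y : ZMod 2) = p'
    generalize (Q.count y : ZMod 2) = q'
    generalize (R.count y : ZMod 2) = r'
    linear_combination (-p * q' - q * q' - p * r' - q * r') * two_eq
  clear hcount
  generalize [a] ++ P ++ [b] ++ Q ++ [a] ++ R ++ [b] ++ T = w₁ at *
  generalize [b] ++ R ++ [a] ++ Q ++ [b] ++ P ++ [a] ++ T = w₂ at *
  simp only [_root_.pivot, PivotToggles, hadj']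
  by_cases hxy : x = y
  · subst hxy; simp
  have hyx := Ne.symm hxy
  by_cases hxa : x = a
  · subst hxa
    by_cases hyb : y = b
    · subst hyb; simp [adj_ab, hxy]
    · simp [adj_a y hyx hyb, hxy]
  by_cases hxb : x = b
  · subst hxb
    by_cases hya : y = a
    · subst hya; simp [adj_ab, hxy]
    · simp [adj_b y hya hyx, hxy]
  by_cases hya : y = a
  · subst hya; simp [adj_a x hxa hxb, hxy]
  by_cases hyb : y = b
  · subst hyb; simp [adj_b x hxa hxb, hxy]
  rw [adj_xy x y hxa hxb hya hyb, (adj_a x hxa hxb).1.1, (adj_b x hxa hxb).1.1,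
    (adj_a y hya hyb).1.1, (adj_b y hya hyb).1.1]
  simp only [ne_eq, hxy, hxa, hxb, hya, hyb, not_false_eq_true, true_and]
  generalize pairParity _ x y = c
  generalize (P.count x + Q.count x : ZMod 2) = d
  generalize (Q.count x + R.count x : ZMod 2) = e
  generalize (P.count y + Q.count y : ZMod 2) = d'
  generalize (Q.count y + R.count y : ZMod 2) = e'
  revert c d e d' e'
  decide

end Words

/-! ### Nonsingular principal submatrices over `ZMod 2` and the pivot recursion. -/

section LinearAlgebra

open Classical in
/-- The adjacency matrix of `H` over `ZMod 2` applied to the vector `x`. -/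
noncomputable def neighborSum {V : Type*} [Fintype V] (H : SimpleGraph V) (x : V → ZMod 2) (v : V) :
    ZMod 2 :=
  ∑ u, if H.Adj v u then x u else 0

/-- The principal submatrix of the adjacency matrix of `H` over `ZMod 2` indexed by `S` is
nonsingular. -/
def IsNonsingularOn {V : Type*} [Fintype V] (H : SimpleGraph V) (S : Set V) : Prop :=
  ∀ x : V → ZMod 2, (∀ v ∉ S, x v = 0) → (∀ v ∈ S, neighborSum H x v = 0) → x = 0

/-- The number of nonsingular principal submatrices of the adjacency matrix over `ZMod 2`. -/
noncomputable def numNonsingular {V : Type*} [Fintype V] (H : SimpleGraph V) : ℕ :=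
  Nat.card {S : Set V // IsNonsingularOn H S}

variable {V : Type*} [Fintype V]

theorem numNonsingular_of_forall_not_adj {H : SimpleGraph V} (hH : ∀ a b, ¬ H.Adj a b) :
    numNonsingular H = 1 := by
  classical
  have h : ∀ S : Set V, IsNonsingularOn H S ↔ S = ∅ := by
    intro S
    constructor
    · intro hS
      by_contra hne
      obtain ⟨v, hv⟩ := Set.nonempty_iff_ne_empty.2 hne
      have := hS (Pi.single v 1) (fun u hu => Pi.single_eq_of_ne (by rintro rfl; exact hu hv) _)
        (fun u _ => by simp [neighborSum, hH])
      simpa using congrFun this v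
    · rintro rfl x hx -
      exact funext fun v => hx v (by simp)
  simp [numNonsingular, h]

/-- Vectors supported on a set avoiding `a` are the extensions by zero of vectors on the remaining
vertices, and the term at `a` contributes nothing to neighbor sums. -/
theorem isNonsingularOn_deleteVertex (H : SimpleGraph V) (a : V)
    [Fintype ({a}ᶜ : Set V)] (S : Set ({a}ᶜ : Set V)) :
    IsNonsingularOn (deleteVertex H a) S ↔ IsNonsingularOn H ((↑) '' S) := by
  classical
  have sum_eq : ∀ f : V → ZMod 2, f a = 0 → ∑ u, f u = ∑ u : ({a}ᶜ : Set V), f u := by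
    intro f hf
    rw [← Finset.sum_subtype ({a}ᶜ : Finset V) (fun x => by simp) f, ← Finset.sum_compl_add_sum {a}]
    simp [hf]
  constructor
  · intro h x hx hs
    have hxa : x a = 0 := hx a (by rintro ⟨v, -, hv⟩; exact v.2 hv)
    have := h (fun v => x v) (fun v hv => hx v (by rintro ⟨u, hu, huv⟩; exact hv (Subtype.ext huv ▸ hu))) (fun v hv => by
      rw [← hs v ⟨v, hv, rfl⟩, neighborSum, neighborSum, sum_eq _ (by simp [hxa])]
      rfl)
    funext v
    by_cases hv : v = a
    · rw [hv, hxa]; rfl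
    · exact congrFun this ⟨v, hv⟩
  · intro h x hx hs
    let x' : V → ZMod 2 := fun v => if hv : v = a then 0 else x ⟨v, hv⟩
    have hx'a : x' a = 0 := dif_pos rfl
    have hx' : ∀ v : ({a}ᶜ : Set V), x' v = x v := fun v => dif_neg v.2
    have := h x' (fun v hv => by
        by_cases hva : v = a
        · rw [hva, hx'a]
        · rw [hx' ⟨v, hva⟩]
          exact hx _ fun h' => hv ⟨_, h', rfl⟩) (by
        rintro _ ⟨v, hv, rfl⟩
        rw [← hs v hv, neighborSum, neighborSum, sum_eq _ (by simp [hx'a])]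
        simp only [hx']
        rfl)
    funext v
    rw [← hx', this]
    rfl

theorem card_nonsingular_notMem (H : SimpleGraph V) (a : V) [Fintype ({a}ᶜ : Set V)] :
    Nat.card {S : Set V // IsNonsingularOn H S ∧ a ∉ S} = numNonsingular (deleteVertex H a) := by
  symm
  refine Nat.card_congr (Equiv.ofBijective (fun S => ⟨(↑) '' S.1,
    (isNonsingularOn_deleteVertex H a S.1).1 S.2, by rintro ⟨v, -, hv⟩; exact v.2 hv⟩) ⟨?_, ?_⟩)
  · intro S T h
    exact Subtype.ext (Subtype.val_injective.image_injective (congrArg Subtype.val h))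
  · rintro ⟨S, hS, ha⟩
    have hS' : (↑) '' ((↑) ⁻¹' S : Set ({a}ᶜ : Set V)) = S := by
      rw [Subtype.image_preimage_coe, Set.inter_eq_right]
      rintro v hv rfl
      exact ha hv
    exact ⟨⟨(↑) ⁻¹' S, (isNonsingularOn_deleteVertex H a _).2 (by rwa [hS'])⟩, Subtype.ext hS'⟩

/-- The effect on index sets of a pivot on `ab`, after exchanging the names `a` and `b`. -/
def pivotSet {V : Type*} (a b : V) (S : Set V) : Set V :=
  {v | (v = a ∧ b ∉ S) ∨ (v = b ∧ a ∉ S) ∨ (v ≠ a ∧ v ≠ b ∧ v ∈ S)}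

theorem pivotSet_pivotSet {V : Type*} {a b : V} (hab : a ≠ b) (S : Set V) :
    pivotSet a b (pivotSet a b S) = S := by
  ext v
  have := hab.symm
  by_cases ha : v = a
  · subst ha; simp [pivotSet, *]
  · by_cases hb : v = b
    · subst hb; simp [pivotSet, *]
    · simp [pivotSet, *]

theorem pivot_pivot {V : Type*} {H : SimpleGraph V} {a b : V} :
    pivot (pivot H a b) a b = H := by
  have h₁ : ∀ x, (pivot H a b).Adj x a ↔ H.Adj x a := fun x => by
    simp [pivot, PivotToggles]
  have h₂ : ∀ x, (pivot H a b).Adj x b ↔ H.Adj x b := fun x => by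
    simp [pivot, PivotToggles]
  have h₃ : ∀ x y, PivotToggles (pivot H a b) a b x y ↔ PivotToggles H a b x y := fun x y => by
    simp only [PivotToggles, h₁, h₂]
  ext x y
  change ((pivot H a b).Adj x y ∧ ¬ PivotToggles (pivot H a b) a b x y) ∨
    (¬ (pivot H a b).Adj x y ∧ PivotToggles (pivot H a b) a b x y) ↔ _
  rw [h₃]
  simp only [pivot]
  tauto

/-- Principal pivot transform: with `y = A x`, put `y b` and `y a` in place of `x a` and `x b`. The
pivoted matrix sends this vector to `x b` at `a`, `x a` at `b`, and `y v` elsewhere. A kernel vector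
for `S` thus becomes one for `pivotSet a b S`, and `x` is recovered from the new vector and its
image. -/
theorem IsNonsingularOn.of_pivot {H : SimpleGraph V} {a b : V} (hab : H.Adj a b) {S : Set V}
    (h : IsNonsingularOn (pivot H a b) (pivotSet a b S)) : IsNonsingularOn H S := by
  classical
  have hne := hab.ne
  intro x hx hs
  let y := neighborSum H x
  let x' : V → ZMod 2 := fun v => if v = a then y b else if v = b then y a else x v
  let A : V → V → ZMod 2 := fun v u => if H.Adj v u then 1 else 0
  let B : V → V → ZMod 2 := fun v u => if (pivot H a b).Adj v u then 1 else 0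
  have hA : ∀ x v, neighborSum H x v = ∑ u, A v u * x u := fun x v => by
    simp [neighborSum, A]
  have hB : ∀ x v, neighborSum (pivot H a b) x v = ∑ u, B v u * x u := fun x v => by
    simp [neighborSum, B]
  have split : ∀ f : V → ZMod 2, ∑ u, f u = f a + f b + ∑ u ∈ ({a, b}ᶜ : Finset V), f u := by
    intro f
    rw [← Finset.sum_add_sum_compl {a, b}, Finset.sum_pair hne]
  have hAab : A a b = 1 := by simp [A, hab]
  have hAba : A b a = 1 := by simp [A, hab.symm]
  have hAaa : A a a = 0 := by simp [A]
  have hAbb : A b b = 0 := by simp [A]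
  have hBa : ∀ v, B a v = A a v := fun v => by simp [A, B, pivot, PivotToggles]
  have hBb : ∀ v, B b v = A b v := fun v => by simp [A, B, pivot, PivotToggles]
  have hBa' : ∀ v, B v a = A v a := fun v => by simp [A, B, pivot, PivotToggles]
  have hBb' : ∀ v, B v b = A v b := fun v => by simp [A, B, pivot, PivotToggles]
  -- Toggling is the addition of a 2 by 2 determinant, the Schur complement formula for the block on
  -- `a`, `b`.
  have hBuv : ∀ v u, v ≠ a → v ≠ b → u ≠ a → u ≠ b →
      B v u = A v u + A v a * A b u + A v b * A a u := by
    intro v u hva hvb hua hub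
    simp only [A, B, pivot, PivotToggles, H.adj_comm a u, H.adj_comm b u]
    by_cases h₁ : H.Adj v u <;> by_cases h₂ : H.Adj v a <;> by_cases h₃ : H.Adj v b <;>
      by_cases h₄ : H.Adj u a <;> by_cases h₅ : H.Adj u b <;>
      simp [h₁, h₂, h₃, h₄, h₅, hva, hvb, hua, hub] <;> decide
  have hx'a : x' a = y b := by simp [x']
  have hx'b : x' b = y a := by simp [x', hne.symm]
  have hx' : ∀ u, u ≠ a → u ≠ b → x' u = x u := fun u h₁ h₂ => by simp [x', h₁, h₂]
  have hsum : ∀ v, ∑ u ∈ ({a, b}ᶜ : Finset V), A v u * x' u =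
      ∑ u ∈ ({a, b}ᶜ : Finset V), A v u * x u := fun v =>
    Finset.sum_congr rfl fun u hu => by
      simp only [Finset.mem_compl, Finset.mem_insert, Finset.mem_singleton, not_or] at hu
      rw [hx' u hu.1 hu.2]
  have hya : y a = x b + ∑ u ∈ ({a, b}ᶜ : Finset V), A a u * x u := by
    simp only [y, hA, split, hAaa, hAab]; ring
  have hyb : y b = x a + ∑ u ∈ ({a, b}ᶜ : Finset V), A b u * x u := by
    simp only [y, hA, split, hAba, hAbb]; ring
  have two_eq : (2 : ZMod 2) = 0 := rfl
  have hy'a : neighborSum (pivot H a b) x' a = x b := by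
    rw [hB, split]
    simp only [hBa, hAaa, hAab, hsum, hx'b, hya]
    linear_combination (∑ u ∈ ({a, b}ᶜ : Finset V), A a u * x u) * two_eq
  have hy'b : neighborSum (pivot H a b) x' b = x a := by
    rw [hB, split]
    simp only [hBb, hAbb, hAba, hsum, hx'a, hyb]
    linear_combination (∑ u ∈ ({a, b}ᶜ : Finset V), A b u * x u) * two_eq
  have hy' : ∀ v, v ≠ a → v ≠ b → neighborSum (pivot H a b) x' v = y v := by
    intro v hva hvb
    have hBsum : ∑ u ∈ ({a, b}ᶜ : Finset V), B v u * x' u =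
        (∑ u ∈ ({a, b}ᶜ : Finset V), A v u * x u) +
          A v a * (∑ u ∈ ({a, b}ᶜ : Finset V), A b u * x u) +
          A v b * (∑ u ∈ ({a, b}ᶜ : Finset V), A a u * x u) := by
      rw [Finset.mul_sum, Finset.mul_sum, ← Finset.sum_add_distrib, ← Finset.sum_add_distrib]
      refine Finset.sum_congr rfl fun u hu => ?_
      simp only [Finset.mem_compl, Finset.mem_insert, Finset.mem_singleton, not_or] at hu
      rw [hBuv v u hva hvb hu.1 hu.2, hx' u hu.1 hu.2]
      ring
    have hyv : y v = A v a * x a + A v b * x b + ∑ u ∈ ({a, b}ᶜ : Finset V), A v u * x u := by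
      simp only [y, hA, split]
    rw [hB, split, hBsum, hBa', hBb', hx'a, hx'b, hya, hyb, hyv]
    linear_combination (A v a * (∑ u ∈ ({a, b}ᶜ : Finset V), A b u * x u) +
      A v b * (∑ u ∈ ({a, b}ᶜ : Finset V), A a u * x u)) * two_eq
  have hzero := h x' (fun v hv => by
      simp only [pivotSet, Set.mem_ofPred_eq, not_or, not_and, not_not] at hv
      by_cases hva : v = a
      · rw [hva, hx'a]; exact hs b (hv.1 hva)
      · by_cases hvb : v = b
        · rw [hvb, hx'b]; exact hs a (hv.2.1 hvb)
        · rw [hx' v hva hvb]; exact hx v (hv.2.2 hva hvb))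
    (fun v hv => by
      rcases hv with ⟨rfl, hv⟩ | ⟨rfl, hv⟩ | ⟨hva, hvb, hv⟩
      · rw [hy'a]; exact hx b hv
      · rw [hy'b]; exact hx a hv
      · rw [hy' v hva hvb]; exact hs v hv)
  rw [hzero] at hy'a hy'b
  funext v
  by_cases hva : v = a
  · rw [hva, ← hy'b]; simp [neighborSum]
  · by_cases hvb : v = b
    · rw [hvb, ← hy'a]; simp [neighborSum]
    · rw [← hx' v hva hvb, hzero]

/-- Both the pivot and the operation on sets are involutions, so one implication applied to the
pivoted graph yields the other. -/
theorem isNonsingularOn_pivot_iff {H : SimpleGraph V} {a b : V} (hab : H.Adj a b) {S : Set V} :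
    IsNonsingularOn (pivot H a b) (pivotSet a b S) ↔ IsNonsingularOn H S := by
  refine ⟨.of_pivot hab, fun h => ?_⟩
  have hab' : (pivot H a b).Adj a b := by simp [pivot, PivotToggles, hab]
  refine .of_pivot hab' ?_
  rwa [pivot_pivot, pivotSet_pivotSet hab.ne]

theorem card_nonsingular_mem {H : SimpleGraph V} {a b : V} (hab : H.Adj a b)
    [Fintype ({b}ᶜ : Set V)] :
    Nat.card {S : Set V // IsNonsingularOn H S ∧ a ∈ S} =
      numNonsingular (deleteVertex (pivot H a b) b) := by
  rw [← card_nonsingular_notMem]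
  have hb : ∀ S, b ∉ pivotSet a b S ↔ a ∈ S := fun S => by simp [pivotSet, hab.ne.symm]
  refine Nat.card_congr (Equiv.subtypeEquiv
    (Function.Involutive.toPerm _ (pivotSet_pivotSet hab.ne)) fun S => ?_)
  change _ ↔ IsNonsingularOn _ (pivotSet a b S) ∧ b ∉ pivotSet a b S
  rw [isNonsingularOn_pivot_iff hab, hb]

theorem numNonsingular_eq_add {H : SimpleGraph V} {a b : V} (hab : H.Adj a b)
    [Fintype ({a}ᶜ : Set V)] [Fintype ({b}ᶜ : Set V)] :
    numNonsingular H =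
      numNonsingular (deleteVertex H a) + numNonsingular (deleteVertex (pivot H a b) b) := by
  classical
  rw [← card_nonsingular_notMem, ← card_nonsingular_mem hab, add_comm, numNonsingular,
    ← Nat.card_sum]
  refine Nat.card_congr ((Equiv.sumCompl fun S : {S // IsNonsingularOn H S} => a ∈ S.1).symm.trans
    (Equiv.sumCongr ?_ ?_))
  · exact Equiv.subtypeSubtypeEquivSubtypeInter (IsNonsingularOn H) fun S => a ∈ S
  · exact Equiv.subtypeSubtypeEquivSubtypeInter (IsNonsingularOn H) fun S => a ∉ S

end LinearAlgebra

/-! ### Suffix sums along a circuit and the matrix of pair parities. -/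

section SuffixSum

variable {V E : Type*} [DecidableEq V] [DecidableEq E]

/-- The sum of `y` over the entries of a list strictly after the first occurrence of `e`. -/
def suffixSum {M : Type*} [AddCommMonoid M] (y : E → M) : List E → E → M
  | [], _ => 0
  | a :: l, e => if e = a then (l.map y).sum else suffixSum y l e

theorem suffixSum_getElem {M : Type*} [AddCommMonoid M] (y : E → M) {l : List E} (hl : l.Nodup)
    (i : ℕ) (h : i < l.length) : suffixSum y l l[i] = ((l.drop (i + 1)).map y).sum := by
  induction l generalizing i with
  | nil => simp at h
  | cons a l ih =>
    rw [List.nodup_cons] at hl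
    rcases i with _ | i
    · simp [suffixSum]
    · have h' : i < l.length := by simpa using h
      have hne : l[i] ≠ a := by rintro rfl; exact hl.1 (List.getElem_mem h')
      simp [suffixSum, hne, ih hl.2 i h']

/-- Within the list this drops one term. At the wrap from last entry to first, the left side is the
empty sum and the right side the full sum, hence the vanishing total. -/
theorem suffixSum_formPerm {M : Type*} [AddCommMonoid M] (y : E → M) {l : List E} (hl : l.Nodup)
    (hy : (l.map y).sum = 0) {e : E} (he : e ∈ l) :
    suffixSum y l e = y (l.formPerm e) + suffixSum y l (l.formPerm e) := by
  obtain ⟨i, hi, rfl⟩ := List.getElem_of_mem he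
  rw [List.formPerm_apply_getElem _ hl, suffixSum_getElem y hl, suffixSum_getElem y hl,
    ← List.sum_cons, ← List.map_cons, ← List.drop_eq_getElem_cons]
  rcases Nat.lt_or_ge (i + 1) l.length with h | h
  · rw [Nat.mod_eq_of_lt h]
  · have h' : i + 1 = l.length := by omega
    simp [h', hy]

theorem sum_count_mul [Fintype V] {R : Type*} [Semiring R] (m : List V) (x : V → R) :
    ∑ u, (m.count u : R) * x u = (m.map x).sum := by
  induction m with
  | nil => simp
  | cons a m ih =>
    simp only [List.count_cons, List.map_cons, List.sum_cons, Nat.cast_add, add_mul,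
      Finset.sum_add_distrib, ih, beq_iff_eq, Nat.cast_ite, ite_mul, Nat.cast_one, Nat.cast_zero,
      one_mul, zero_mul, Finset.sum_ite_eq, Finset.mem_univ, if_true, add_comm]

/-- Double counting: each occurrence of `v` contributes the sum of `x` over all later letters. -/
theorem sum_pairParity_mul [Fintype V] (t : E → V) (x : V → ZMod 2) {l : List E} (hl : l.Nodup)
    (v : V) :
    ∑ u, pairParity (l.map t) v u * x u =
      (l.map fun e => if t e = v then suffixSum (x ∘ t) l e else 0).sum := by
  induction l with
  | nil => simp [pairParity]
  | cons a l ih =>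
    rw [List.nodup_cons] at hl
    have h : (l.map fun e => if t e = v then suffixSum (x ∘ t) (a :: l) e else 0) =
        l.map fun e => if t e = v then suffixSum (x ∘ t) l e else 0 := by
      refine List.map_congr_left fun e he => ?_
      have hne : e ≠ a := by rintro rfl; exact hl.1 he
      simp [suffixSum, hne]
    rw [List.map_cons, List.map_cons, List.sum_cons, h, ← ih hl.2]
    simp only [pairParity, add_mul, Finset.sum_add_distrib, suffixSum, if_true]
    congr 1
    split_ifs
    · rw [sum_count_mul, List.map_map]
    · simp

theorem pairParity_self (l : List V) (v : V) :
    pairParity l v v = ((l.count v).choose 2 : ZMod 2) := by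
  induction l with
  | nil => rfl
  | cons z l ih =>
    by_cases h : z = v
    · subst h
      simp [pairParity, ih, Nat.choose_succ_succ' _ 1]
    · simp [pairParity, ih, h]

/-- The pair parities form the matrix `I + A`: a letter occurring twice has exactly one ordered pair
with itself, which gives the diagonal. -/
theorem sum_pairParity_mul_eq_neighborSum [Fintype V] {H : SimpleGraph V} {w : List V}
    (hw : ∀ v, w.count v = 2) (hH : ∀ a b, H.Adj a b ↔ a ≠ b ∧ pairParity w a b = 1)
    (x : V → ZMod 2) (v : V) : ∑ u, pairParity w v u * x u = x v + neighborSum H x v := by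
  classical
  have h : ∀ u, pairParity w v u * x u =
      (if v = u then x u else 0) + if H.Adj v u then x u else 0 := by
    intro u
    by_cases huv : v = u
    · subst huv
      rw [pairParity_self, hw]
      simp
    · have h01 : ∀ c : ZMod 2, c = 0 ∨ c = 1 := by decide
      rcases h01 (pairParity w v u) with h | h <;> simp [hH, huv, h]
  simp only [h, Finset.sum_add_distrib, neighborSum, Finset.sum_ite_eq, Finset.mem_univ, if_true]

end SuffixSum

/-! ### Euler circuits as transitive permutations of the edges. -/

section Transitive

variable {E : Type*}

theorem Equiv.Perm.forall_sameCycle_iff_forall_invariant {π : Equiv.Perm E} :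
    (∀ e e', π.SameCycle e e') ↔
      ∀ f : E → ZMod 2, (∀ e, f (π e) = f e) → ∀ e e', f e = f e' := by
  constructor
  · intro h f hf e e'
    obtain ⟨i, rfl⟩ := h e e'
    induction i using Int.induction_on with
    | zero => rfl
    | succ i ih => rw [add_comm, zpow_add, zpow_one, Equiv.Perm.mul_apply, hf, ih]
    | pred i ih =>
      rw [ih, ← hf ((π ^ (-(i : ℤ) - 1)) e), ← Equiv.Perm.mul_apply, ← zpow_one_add]
      congr 3
      ring
  · intro h e e'
    classical
    -- The indicator function of an orbit is invariant.
    have := h (fun z => if π.SameCycle e z then 1 else 0)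
      (fun z => by simp only [Equiv.Perm.sameCycle_apply_right]) e e'
    simpa [Equiv.Perm.SameCycle.refl] using this

theorem Equiv.Perm.isCycle_of_forall_sameCycle [Nontrivial E] {π : Equiv.Perm E}
    (h : ∀ e e', π.SameCycle e e') : π.IsCycle ∧ ∀ e, π e ≠ e := by
  have hne : ∀ e, π e ≠ e := by
    intro e he
    obtain ⟨e', he'⟩ := exists_ne e
    obtain ⟨i, hi⟩ := h e e'
    exact he' (hi ▸ Equiv.Perm.zpow_apply_eq_self_of_apply_eq_self he i)
  obtain ⟨e⟩ : Nonempty E := inferInstance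
  exact ⟨⟨e, hne e, fun e' _ => h e e'⟩, hne⟩

theorem Cycle.nontrivial_of_forall_mem [_root_.Nontrivial E] {C : Cycle E} (h : ∀ e, e ∈ C) :
    C.Nontrivial := by
  obtain ⟨x, y, hxy⟩ := exists_pair_ne E
  exact ⟨x, y, hxy, h x, h y⟩

theorem Cycle.sameCycle_formPerm [DecidableEq E] [_root_.Nontrivial E] {C : Cycle E} (hn : C.Nodup)
    (h : ∀ e, e ∈ C) (e e' : E) : (C.formPerm hn).SameCycle e e' := by
  have hC := C.isCycle_formPerm hn (Cycle.nontrivial_of_forall_mem h)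
  have hne : ∀ e, C.formPerm hn e ≠ e := by
    intro e
    induction C using Quotient.inductionOn with | h l => ?_
    have hl : l.Nodup := hn
    have h2 : 2 ≤ l.length := by
      have := Cycle.length_nontrivial (Cycle.nontrivial_of_forall_mem h)
      simpa using this
    exact (List.formPerm_apply_mem_ne_self_iff l hl e (h e)).2 h2
  exact hC.sameCycle (hne e) (hne e')

theorem Cycle.chain_iff_formPerm [DecidableEq E] {r : E → E → Prop} {C : Cycle E} (hn : C.Nodup)
    (h : ∀ e, e ∈ C) : C.Chain r ↔ ∀ e, r e (C.formPerm hn e) := by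
  induction C using Quotient.inductionOn with | h l => ?_
  have hl : l.Nodup := hn
  change Cycle.Chain r (l : Cycle E) ↔ ∀ e, r e (l.formPerm e)
  rw [Cycle.chain_coe_iff_getElem]
  constructor
  · intro H e
    obtain ⟨i, hi, rfl⟩ := List.getElem_of_mem (Cycle.mem_coe_iff.1 (h e))
    rw [List.formPerm_apply_getElem _ hl]
    exact H i hi
  · intro H i hi
    have := H l[i]
    rwa [List.formPerm_apply_getElem _ hl] at this

/-- Euler circuits correspond to permutations of the edges with a single orbit. -/
theorem MultiDigraph.numEulerCircuits_eq_card_perm {V E : Type u} [Finite E] [Nontrivial E]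
    (D : MultiDigraph V E) :
    D.numEulerCircuits =
      Nat.card {π : Equiv.Perm E // (∀ e, D.head e = D.tail (π e)) ∧ ∀ e e', π.SameCycle e e'} := by
  classical
  have := Fintype.ofFinite E
  refine Nat.card_congr (Equiv.ofBijective (fun C => ⟨C.1.formPerm C.2.1,
    (Cycle.chain_iff_formPerm C.2.1 C.2.2.1).1 C.2.2.2,
    Cycle.sameCycle_formPerm C.2.1 C.2.2.1⟩) ⟨?_, ?_⟩)
  · rintro ⟨C, hC⟩ ⟨C', hC'⟩ h
    rcases Cycle.formPerm_eq_formPerm_iff.1 (congrArg Subtype.val h) with h | ⟨h, -⟩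
    · exact Subtype.ext h
    -- Cycles with at most one entry all induce the identity; having at least two edges excludes
    -- them.
    · exact absurd h (hC.1.nontrivial_iff.1 (Cycle.nontrivial_of_forall_mem hC.2.1))
  · rintro ⟨π, hπ, ht⟩
    obtain ⟨hcyc, hne⟩ := Equiv.Perm.isCycle_of_forall_sameCycle ht
    have hform : (π.toCycle hcyc).formPerm (Equiv.Perm.nodup_toCycle π hcyc) = π :=
      congrArg Subtype.val (Equiv.Perm.isoCycle.left_inv ⟨π, hcyc⟩)
    have hmem : ∀ e, e ∈ π.toCycle hcyc := fun e =>
      (Equiv.Perm.mem_toCycle_iff_support π hcyc).2 (hne e)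
    refine ⟨⟨π.toCycle hcyc, Equiv.Perm.nodup_toCycle π hcyc, hmem, ?_⟩, Subtype.ext hform⟩
    rw [Cycle.chain_iff_formPerm (Equiv.Perm.nodup_toCycle π hcyc) hmem, hform]
    exact hπ

end Transitive

/-! ### Euler circuits counted by nonsingular sets. -/

namespace MultiDigraph

variable {V E : Type u}

theorem IsTwoInTwoOut.exists_partner {D : MultiDigraph V E} (hD : D.IsTwoInTwoOut) :
    ∃ τ : E → E, (∀ e, τ e ≠ e) ∧ (∀ e, D.tail (τ e) = D.tail e) ∧
      ∀ e e', D.tail e' = D.tail e → e' = e ∨ e' = τ e := by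
  have h : ∀ e, ∃ e', e' ≠ e ∧ D.tail e' = D.tail e ∧
      ∀ e'', D.tail e'' = D.tail e → e'' = e ∨ e'' = e' := by
    intro e
    obtain ⟨x, y, hxy, hS⟩ := Set.ncard_eq_two.1 (hD (D.tail e)).2
    have hmem : ∀ z, D.tail z = D.tail e ↔ z = x ∨ z = y := fun z => by
      have := Set.ext_iff.1 hS z
      simpa using this
    rcases (hmem e).1 rfl with rfl | rfl
    · exact ⟨y, hxy.symm, (hmem y).2 (Or.inr rfl), fun z hz => (hmem z).1 hz⟩
    · exact ⟨x, hxy, (hmem x).2 (Or.inl rfl), fun z hz => ((hmem z).1 hz).symm⟩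
  choose τ h₁ h₂ h₃ using h
  exact ⟨τ, h₁, h₂, h₃⟩

theorem IsTwoInTwoOut.numEulerCircuits_eq [Fintype V] {D : MultiDigraph V E}
    (hD : D.IsTwoInTwoOut) {C : Cycle E} (hC : D.IsEulerCircuit C) :
    D.numEulerCircuits = numNonsingular (D.interlaceGraph C) := by
  classical
  induction C using Quotient.inductionOn with | h l => ?_
  change D.IsEulerCircuit (l : Cycle E) at hC
  change _ = numNonsingular (D.interlaceGraph (l : Cycle E))
  have hl : l.Nodup := hC.1
  have hmem : ∀ e, e ∈ l := hC.2.1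
  obtain ⟨τ, hτ_ne, hτ_tail, hτ_unique⟩ := hD.exists_partner
  have hτ : Function.Involutive τ := fun e =>
    ((hτ_unique (τ e) e (hτ_tail e).symm).resolve_left (hτ_ne e).symm).symm
  have hfin : Finite E := Set.finite_univ_iff.1 (l.toFinset.finite_toSet.subset fun e _ => by
    simpa using hmem e)
  have := Fintype.ofFinite E
  -- Without edges the degree condition leaves no vertices, and the empty cycle is the only circuit.
  -- Otherwise an edge and its partner give two distinct edges.
  rcases isEmpty_or_nonempty E with hE | ⟨⟨e₀⟩⟩
  · have hV : IsEmpty V := ⟨fun v => by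
      have := (hD v).2
      rw [Set.eq_empty_of_isEmpty {e | D.tail e = v}] at this
      simp at this⟩
    rw [numNonsingular_of_forall_not_adj (fun a => isEmptyElim a), numEulerCircuits,
      Nat.card_eq_one_iff_unique]
    refine ⟨⟨fun ⟨C, hC⟩ ⟨C', hC'⟩ => Subtype.ext ?_⟩, ⟨⟨_, hC⟩⟩⟩
    change C = C'
    have nil : ∀ C : Cycle E, C = Cycle.nil := fun C => by
      induction C using Quotient.inductionOn with | h l => ?_
      rw [List.eq_nil_of_subset_nil (l := l) fun e => isEmptyElim e]
      rfl
    rw [nil C, nil C']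
  have hnt : Nontrivial E := ⟨⟨τ e₀, e₀, hτ_ne e₀⟩⟩
  rw [D.numEulerCircuits_eq_card_perm]
  have hw := hD.count_map_tail hC
  have hH := hD.interlaceGraph_adj_iff hC
  generalize D.interlaceGraph (l : Cycle E) = H at *
  obtain ⟨σ, hσ⟩ : ∃ σ : Equiv.Perm E, σ = l.formPerm := ⟨_, rfl⟩
  have hσ_head : ∀ e, D.head e = D.tail (σ e) := by
    rw [hσ]
    exact (Cycle.chain_iff_formPerm hC.1 hC.2.1).1 hC.2.2
  have hσ_trans : ∀ e e', σ.SameCycle e e' := by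
    rw [hσ]
    exact Cycle.sameCycle_formPerm hC.1 hC.2.1
  have htail_surj : ∀ v, ∃ e, D.tail e = v := fun v => by
    have : v ∈ l.map D.tail := List.count_pos_iff.1 (by rw [hw]; norm_num)
    obtain ⟨e, -, he⟩ := List.mem_map.1 this
    exact ⟨e, he⟩
  have two_eq : (2 : ZMod 2) = 0 := rfl
  have hsuffix : ∀ (x : V → ZMod 2) (e : E), suffixSum (x ∘ D.tail) l e =
      x (D.tail (σ e)) + suffixSum (x ∘ D.tail) l (σ e) := by
    intro x e
    rw [hσ]
    refine suffixSum_formPerm _ hl ?_ (hmem e)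
    rw [← List.map_map, ← sum_count_mul]
    exact Finset.sum_eq_zero fun u _ => by rw [hw, Nat.cast_two, two_eq, zero_mul]
  have hpair : ∀ (x : V → ZMod 2) (e : E),
      suffixSum (x ∘ D.tail) l e + suffixSum (x ∘ D.tail) l (τ e) =
        x (D.tail e) + neighborSum H x (D.tail e) := by
    intro x e
    rw [← sum_pairParity_mul_eq_neighborSum hw hH, sum_pairParity_mul _ _ hl,
      ← List.sum_toFinset _ hl, ← Finset.sum_filter]
    have : l.toFinset.filter (fun e' => D.tail e' = D.tail e) = {e, τ e} := by
      ext e'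
      simp only [Finset.mem_filter, List.mem_toFinset, hmem, true_and, Finset.mem_insert,
        Finset.mem_singleton]
      refine ⟨hτ_unique e e', ?_⟩
      rintro (rfl | rfl)
      · rfl
      · exact hτ_tail e
    rw [this, Finset.sum_pair (hτ_ne e).symm]
  let swap : Set V → Equiv.Perm E := fun S =>
    Function.Involutive.toPerm (fun e => if D.tail e ∈ S then τ e else e) fun e => by
      by_cases h : D.tail e ∈ S <;> simp [h, hτ_tail, hτ e]
  have swap_mem : ∀ S e, D.tail e ∈ S → swap S e = τ e := fun S e h => if_pos h
  have swap_notMem : ∀ S e, D.tail e ∉ S → swap S e = e := fun S e h => if_neg h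
  have swap_tail : ∀ S e, D.tail (swap S e) = D.tail e := fun S e => by
    by_cases h : D.tail e ∈ S
    · rw [swap_mem S e h, hτ_tail]
    · rw [swap_notMem S e h]
  have key : ∀ S : Set V,
      (∀ e e', (swap S * σ).SameCycle e e') ↔ IsNonsingularOn H S := by
    intro S
    rw [Equiv.Perm.forall_sameCycle_iff_forall_invariant]
    constructor
    · intro h x hx hs
      -- For a kernel vector `x` the suffix sum is invariant: passing to `σ e` changes it by `x` at
      -- the tail, and the partner swap at a vertex of `S` undoes that change. Being constant, it
      -- has zero increments, so `x = 0`.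
      have hconst := h (suffixSum (x ∘ D.tail) l) fun e => by
        rw [Equiv.Perm.mul_apply, hsuffix x e]
        by_cases hS : D.tail (σ e) ∈ S
        · rw [swap_mem S _ hS]
          have := hpair x (σ e)
          rw [hs _ hS] at this
          linear_combination this - suffixSum (x ∘ D.tail) l (σ e) * two_eq
        · rw [swap_notMem S _ hS, hx _ hS, zero_add]
      funext v
      obtain ⟨e, rfl⟩ := htail_surj v
      have h₁ := hsuffix x (σ.symm e)
      rw [σ.apply_symm_apply, hconst _ e] at h₁
      simpa using h₁
    · intro h f hf
      choose s hs using htail_surj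
      -- Conversely, `x` is the jump of `f` between the two edges leaving a vertex of `S`. Then `f`
      -- and the suffix sum of `x` have the same increments along `σ`, so they differ by a constant.
      -- Comparing partners at `v ∈ S` gives `x v = x v + (A x) v`, which puts `x` in the kernel.
      let x : V → ZMod 2 := fun v => if v ∈ S then f (s v) + f (τ (s v)) else 0
      have hx : ∀ e, D.tail e ∈ S → x (D.tail e) = f e + f (τ e) := by
        intro e he
        simp only [x, he, if_true]
        rcases hτ_unique e (s (D.tail e)) (hs _) with h | h
        · rw [h]
        · rw [h, hτ e, add_comm]
      have hfx : ∀ e, f e = x (D.tail (σ e)) + f (σ e) := by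
        intro e
        rw [← hf e, Equiv.Perm.mul_apply]
        by_cases hS : D.tail (σ e) ∈ S
        · rw [swap_mem S _ hS, hx _ hS]
          linear_combination -f (σ e) * two_eq
        · rw [swap_notMem S _ hS]
          simp [x, hS]
      have hdiff := Equiv.Perm.forall_sameCycle_iff_forall_invariant.1 hσ_trans
        (fun e => f e + suffixSum (x ∘ D.tail) l e) fun e => by
          rw [hfx e, hsuffix x e]
          linear_combination -x (D.tail (σ e)) * two_eq
      have hx0 := h x (fun v hv => if_neg hv) fun v hv => by
        have h₁ := hpair x (s v)
        have h₂ := hx (s v) (by rwa [hs])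
        have h₃ := hdiff (s v) (τ (s v))
        rw [hs] at h₁ h₂
        linear_combination -h₁ - h₂ + h₃ +
          (suffixSum (x ∘ D.tail) l (τ (s v)) - f (s v)) * two_eq
      refine Equiv.Perm.forall_sameCycle_iff_forall_invariant.1 hσ_trans f fun e => ?_
      have := hfx e
      rw [hx0] at this
      simpa using this.symm
  refine (Nat.card_congr (Equiv.ofBijective (fun S : {S : Set V // IsNonsingularOn H S} =>
    ⟨swap S.1 * σ, fun e => by rw [Equiv.Perm.mul_apply, swap_tail, hσ_head],
      (key S.1).2 S.2⟩) ⟨?_, ?_⟩)).symm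
  · rintro ⟨S, hS⟩ ⟨T, hT⟩ h
    have h' : swap S = swap T := mul_right_cancel (congrArg Subtype.val h)
    refine Subtype.ext (Set.ext fun v => ?_)
    obtain ⟨e, rfl⟩ := htail_surj v
    have he := DFunLike.congr_fun h' e
    change D.tail e ∈ S ↔ D.tail e ∈ T
    by_cases h₁ : D.tail e ∈ S <;> by_cases h₂ : D.tail e ∈ T
    · simp [h₁, h₂]
    · rw [swap_mem S e h₁, swap_notMem T e h₂] at he
      exact absurd he (hτ_ne e)
    · rw [swap_notMem S e h₁, swap_mem T e h₂] at he
      exact absurd he.symm (hτ_ne e)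
    · simp [h₁, h₂]
  · rintro ⟨π, hπ, ht⟩
    -- The vertices where `π` and `σ` pair incoming with outgoing edges differently; with two
    -- outgoing edges, differing means being swapped.
    let S : Set V := {v | ∃ e, D.tail e = v ∧ π (σ.symm e) ≠ e}
    have hπ_tail : ∀ e, D.tail (π (σ.symm e)) = D.tail e := fun e => by
      rw [← hπ, hσ_head, σ.apply_symm_apply]
    have hSπ : swap S * σ = π := by
      refine Equiv.ext fun e' => ?_
      obtain ⟨e, rfl⟩ := σ.symm.surjective e'
      rw [Equiv.Perm.mul_apply, σ.apply_symm_apply]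
      by_cases hS : D.tail e ∈ S
      · rw [swap_mem S e hS]
        refine ((hτ_unique e _ (hπ_tail e)).resolve_left fun he => ?_).symm
        obtain ⟨e', he', hne⟩ := hS
        rcases hτ_unique e e' he' with rfl | rfl
        · exact hne he
        · rcases hτ_unique e _ ((hπ_tail (τ e)).trans (hτ_tail e)) with h | h
          · exact hτ_ne e (σ.symm.injective (π.injective (h.trans he.symm)))
          · exact hne h
      · rw [swap_notMem S e hS]
        by_contra hne
        exact hS ⟨e, rfl, fun h => hne h.symm⟩
    exact ⟨⟨S, (key S).1 (by rwa [hSπ])⟩, Subtype.ext hSπ⟩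

end MultiDigraph

/-! ### The invariant, its recursion and uniqueness. -/

/-- The interlace invariant: the number of nonsingular principal submatrices of the adjacency
matrix over `ZMod 2`. -/
noncomputable def interlaceInvariant : InterlaceGraphFunction.{u} := fun V H hH =>
  letI : Fintype V := @Fintype.ofFinite V hH.finite
  (numNonsingular H : ℤ)

theorem interlaceInvariant_eq {V : Type u} [hV : Fintype V] (H : SimpleGraph V)
    (hH : IsInterlaceGraph H) : interlaceInvariant V H hH = numNonsingular H := by
  rw [interlaceInvariant, Subsingleton.elim (@Fintype.ofFinite V hH.finite) hV]

theorem satisfiesRecursion_interlaceInvariant : SatisfiesRecursion interlaceInvariant.{u} := by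
  classical
  refine ⟨fun V H hH a b hab => ⟨hH.deleteVertex a, (hH.pivot hab).deleteVertex b, ?_⟩,
    fun V H hH h => ?_⟩
  · have := hH.finite
    have := Fintype.ofFinite V
    rw [interlaceInvariant_eq, interlaceInvariant_eq, interlaceInvariant_eq,
      numNonsingular_eq_add hab, Nat.cast_add]
  · have := hH.finite
    have := Fintype.ofFinite V
    rw [interlaceInvariant_eq, numNonsingular_of_forall_not_adj h, Nat.cast_one]

/-- Both graphs on the right of the recursion have one vertex fewer, so any single edge determines
the value by strong induction on the number of vertices. -/
theorem SatisfiesRecursion.unique {q q' : InterlaceGraphFunction.{u}} (hq : SatisfiesRecursion q)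
    (hq' : SatisfiesRecursion q') : q = q' := by
  suffices h : ∀ (n : ℕ) (V : Type u) (H : SimpleGraph V) (hH : IsInterlaceGraph H),
      Nat.card V = n → q V H hH = q' V H hH by
    funext V H hH
    exact h _ V H hH rfl
  intro n
  induction n using Nat.strong_induction_on with | _ n ih => ?_
  rintro V H hH rfl
  by_cases hE : ∃ a b, H.Adj a b
  · obtain ⟨a, b, hab⟩ := hE
    obtain ⟨h₁, h₂, hsum⟩ := hq.1 V H hH a b hab
    obtain ⟨h₁', h₂', hsum'⟩ := hq'.1 V H hH a b hab
    have := hH.finite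
    have hcard : ∀ v : V, Nat.card ({v}ᶜ : Set V) < Nat.card V := fun v =>
      Finite.card_subtype_lt (x := v) fun h => h rfl
    rw [hsum, hsum', ih _ (hcard a) _ _ h₁ rfl, ih _ (hcard b) _ _ h₂ rfl]
  · push Not at hE
    rw [hq.2 V H hH hE, hq'.2 V H hH hE]

theorem theorem9 :
    ∃ q : InterlaceGraphFunction.{u},
      (∀ (V E : Type u) (D : MultiDigraph V E) (C : Cycle E)
        (hD : D.IsTwoInTwoOut) (hC : D.IsEulerCircuit C),
        (D.numEulerCircuits : ℤ) = q V (D.interlaceGraph C) ⟨E, D, C, hD, hC, rfl⟩) ∧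
      SatisfiesRecursion q ∧
      ∀ q' : InterlaceGraphFunction.{u}, SatisfiesRecursion q' → q' = q := by
  refine ⟨interlaceInvariant, fun V E D C hD hC => ?_, satisfiesRecursion_interlaceInvariant,
    fun q' hq' => hq'.unique satisfiesRecursion_interlaceInvariant⟩
  have := IsInterlaceGraph.finite ⟨E, D, C, hD, hC, rfl⟩
  have := Fintype.ofFinite V
  rw [hD.numEulerCircuits_eq hC]
  exact (interlaceInvariant_eq _ _).symm
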